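/- For a topological space $X$ let $C(X)$ be the linear space of all continuous functions $X\to\mathbb R$ and $C^*(X)\subseteq C(X)$ the subspace of bounded functions; let $D(X)$ denote either $C(X)$ or $C^*(X)$ (likewise $D(Y)$ is either $C(Y)$ or $C^*(Y)$, all combinations being allowed), and let $D_p(X)$ be $D(X)$ with the topology of pointwise convergence. A map $T:D_p(X)\to D_p(Y)$ is uniformly continuous if for every neighborhood $U$ of the zero function in $D_p(Y)$ there is a neighborhood $V$ of the zero function in $D_p(X)$ such that $f,g\in D_p(X)$ and $f-g\in V$ imply $T(f)-T(g)\in U$. A sequence of bounded functions is norm bounded if for some $M>0$ all its members have supremum norm at most $M$. The map $T$ is inversely bounded if for every norm bounded sequence $(g_n)_{n\in\mathbb N}$ in $C^*(Y)$ there is a norm bounded sequence $(f_n)_{n\in\mathbb N}$ in $C^*(X)$ with $T(f_n)=g_n$ for every $n\in\mathbb N$. A topological space $X$ is a $\Delta_1$-space if for every sequence $(A_n)_{n\in\mathbb N}$ of pairwise disjoint countable subsets of $X$ there are open sets $U_n\supseteq A_n$ $(n\in\mathbb N)$ such that every point of $X$ lies in only finitely many of the $U_n$. **Theorem.** Let $X$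 and $Y$ be metrizable spaces and let $T:D_p(X)\to D_p(Y)$ be an inversely bounded, uniformly continuous surjection. If $X$ is a $\Delta_1$-space, then $Y$ is a $\Delta_1$-space. -/

import Mathlib

/-- `C(X)`: the linear space of continuous real-valued functions on `X`, as a subspace of `ℝ^X`.
The uniform structure and the topology that its type of elements inherits from the product `X → ℝ`
are those of pointwise convergence, so that this is the space `C_p(X)`. -/
def contFun (X : Type*) [TopologicalSpace X] : Submodule ℝ (X → ℝ) where
  carrier := {f | Continuous f}
  add_mem' := fun {_ _} hf hg => Continuous.add hf hg
  zero_mem' := continuous_const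
  smul_mem' := fun c _ hf => Continuous.const_smul hf c

/-- `C*(X)`: the linear space of bounded continuous real-valued functions on `X`, again as a
subspace of the product `ℝ^X`, so that this is the space `C*_p(X)`. -/
def bddContFun (X : Type*) [TopologicalSpace X] : Submodule ℝ (X → ℝ) where
  carrier := {f | Continuous f ∧ ∃ M : ℝ, ∀ x, |f x| ≤ M}
  add_mem' := fun {f g} hf hg => by
    obtain ⟨hf, M, hM⟩ := hf
    obtain ⟨hg, N, hN⟩ := hg
    exact ⟨hf.add hg, M + N, fun x =>
      (abs_add_le (f x) (g x)).trans (add_le_add (hM x) (hN x))⟩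
  zero_mem' := ⟨continuous_const, 0, fun x => by simp⟩
  smul_mem' := fun c f hf => by
    obtain ⟨hf, M, hM⟩ := hf
    refine ⟨hf.const_smul c, |c| * M, fun x => ?_⟩
    simpa [abs_mul] using mul_le_mul_of_nonneg_left (hM x) (abs_nonneg c)

/-- A sequence of real-valued functions is norm bounded if, for some `M > 0`, all its members have
supremum norm at most `M`; in particular all its members are bounded functions. -/
def NormBoundedSeq {X : Type*} (f : ℕ → X → ℝ) : Prop :=
  ∃ M : ℝ, 0 < M ∧ ∀ n x, |f n x| ≤ M

/-- A map `T` between function spaces is inversely bounded if every norm bounded sequence `g` in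
`C*(Y)` is the image `T (f n) = g n` of some norm bounded sequence `f` in `C*(X)`. -/
def InverselyBounded {X Y : Type*} {DX : Submodule ℝ (X → ℝ)} {DY : Submodule ℝ (Y → ℝ)}
    (T : DX → DY) : Prop :=
  ∀ g : ℕ → DY, NormBoundedSeq (fun n => (g n : Y → ℝ)) →
    ∃ f : ℕ → DX, NormBoundedSeq (fun n => (f n : X → ℝ)) ∧ ∀ n, T (f n) = g n

/-- `X` is a `Δ₁`-space: every sequence of pairwise disjoint countable subsets of `X` has a
point-finite open expansion. -/
def IsDeltaOneSpace (X : Type*) [TopologicalSpace X] : Prop :=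
  ∀ A : ℕ → Set X, (∀ n, (A n).Countable) → Pairwise (fun m n => Disjoint (A m) (A n)) →
    ∃ U : ℕ → Set X, (∀ n, IsOpen (U n)) ∧ (∀ n, A n ⊆ U n) ∧ ∀ x, {n | x ∈ U n}.Finite

/-! For metrizable spaces, `Δ₁` means that every countable set is `Gδ`. Uniform continuity gives
each `y` a finite support `K ⊆ X` on which `T f y` depends up to an error `q`. Supports intersect at
the cost of adding errors, and limits of supports are supports. Let `B ⊆ Y` be countable. The
supports of its points that no smaller set can replace at error `2q` form a countable, hence `Gδ`,
set `A = ⋂ O k`. The points `y` such that each support of `y` leaving some `O k` can be so replaced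
form a `Gδ` set `G ⊇ B`. Every `y ∈ G` has a minimal support inside `A`, and inverse boundedness
lets only finitely many `y` share a support and an error. So `G` is countable, and `B` is `G` minus
a countable set. -/

open Set Filter Topology

/-! ### The `Δ₁` property and countable `Gδ` sets -/

/-- In a `T₁`-space whose countable subsets are `Gδ`, disjoint countable sets have point-finite
open expansions. -/
theorem isDeltaOneSpace_of_countable_isGδ {Y : Type*} [TopologicalSpace Y] [T1Space Y]
    (h : ∀ B : Set Y, B.Countable → IsGδ B) : IsDeltaOneSpace Y := by
  intro A hA hdisj
  have hAc : (⋃ n, A n).Countable := countable_iUnion hA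
  obtain ⟨O, hO, hAO⟩ := (h _ hAc).eq_iInter_nat
  rcases (⋃ n, A n).eq_empty_or_nonempty with he | hne
  · refine ⟨fun _ => ∅, fun _ => isOpen_empty, fun n => ?_, fun x => by simp⟩
    exact he ▸ subset_iUnion A n
  obtain ⟨a, ha⟩ := hAc.exists_eq_range hne
  have hfin : ∀ n, (a '' Iio n).Finite := fun n => (finite_Iio n).image a
  -- The `O k` expel points outside the union; a point `a j` of `A m` is removed as soon as `n > max
  -- j m`.
  refine ⟨fun n => (⋂ k ∈ Iic n, O k) \ (a '' Iio n \ A n), fun n => ?_, fun n x hx => ?_,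
    fun x => ?_⟩
  · exact ((finite_Iic n).isOpen_biInter fun k _ => hO k).sdiff
      ((hfin n).subset sdiff_subset).isClosed
  · refine ⟨mem_iInter₂.2 fun k _ => ?_, fun h => h.2 hx⟩
    exact mem_iInter.1 (hAO ▸ mem_iUnion.2 ⟨n, hx⟩ : x ∈ ⋂ k, O k) k
  · by_cases hx : x ∈ ⋃ n, A n
    · obtain ⟨j, rfl⟩ : x ∈ range a := ha ▸ hx
      obtain ⟨m, hm⟩ := mem_iUnion.1 hx
      refine (finite_Iic (max j m)).subset fun n hn => ?_
      by_contra hlt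
      rw [mem_Iic, not_le, max_lt_iff] at hlt
      exact hn.2 ⟨mem_image_of_mem a hlt.1,
        fun h => disjoint_left.1 (hdisj hlt.2.ne) hm h⟩
    · obtain ⟨k, hk⟩ : ∃ k, x ∉ O k := by
        by_contra! hc
        exact hx (hAO ▸ mem_iInter.2 hc)
      refine (finite_Iio k).subset fun n hn => ?_
      by_contra hlt
      exact hk (mem_iInter₂.1 hn.1 k (mem_Iic.2 (not_lt.1 hlt)))

/-- Countable subsets of a `T₁`, first countable `Δ₁`-space are `Gδ`. -/
theorem IsDeltaOneSpace.isGδ_of_countable {X : Type*} [TopologicalSpace X] [T1Space X]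
    [FirstCountableTopology X] (h : IsDeltaOneSpace X) {A : Set X} (hA : A.Countable) :
    IsGδ A := by
  rcases A.finite_or_infinite with hfin | hinf
  · exact hfin.isGδ
  have := hA.to_subtype
  have := hinf.to_subtype
  obtain ⟨e⟩ := nonempty_equiv_of_countable (α := ℕ) (β := A)
  obtain ⟨U, hU, hAU, hpf⟩ := h (fun n => {(e n : X)}) (fun n => countable_singleton _)
    (fun m n hmn => by
      exact disjoint_singleton.2 fun he => hmn (e.injective (Subtype.ext he)))
  -- A point outside `A` on the right would lie in `U k` for arbitrarily large `k`, against
  -- point-finiteness.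
  have key : A = ⋂ n : ℕ, ((⋃ k ∈ Ici n, U k) ∪ (fun k => (e k : X)) '' Iio n) := by
    apply Subset.antisymm
    · intro x hx
      obtain ⟨j, hj⟩ := e.surjective ⟨x, hx⟩
      have hj' : (e j : X) = x := by rw [hj]
      refine mem_iInter.2 fun n => ?_
      rcases lt_or_ge j n with hlt | hle
      · exact Or.inr ⟨j, hlt, hj'⟩
      · exact Or.inl (mem_iUnion₂.2 ⟨j, hle, hAU j hj'.symm⟩)
    · intro x hx
      by_contra hxA
      obtain ⟨N, hN⟩ := (hpf x).bddAbove
      rcases mem_iInter.1 hx (N + 1) with h1 | ⟨j, -, rfl⟩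
      · obtain ⟨k, hk, hxk⟩ := mem_iUnion₂.1 h1
        have := hN hxk
        have : N + 1 ≤ k := hk
        omega
      · exact hxA (e j).2
  rw [key]
  exact .iInter fun n => (isOpen_biUnion fun k _ => hU k).isGδ.union
    ((finite_Iio n).image _).isGδ

/-! ### Coarse finite supports -/

/-- The value of `T f` at `y` is determined up to an error `q` by the values of `f` on `K`, when
these are given up to an error less than `1`. -/
def CoarselyDependsOn {X Y : Type*} {DX : Submodule ℝ (X → ℝ)} {DY : Submodule ℝ (Y → ℝ)}
    (T : DX → DY) (y : Y) (K : Finset X) (q : ℝ) : Prop :=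
  ∀ f g : DX, (∀ x ∈ K, |(f : X → ℝ) x - (g : X → ℝ) x| < 1) →
    |(T f : Y → ℝ) y - (T g : Y → ℝ) y| ≤ q

/-- A function space that consists of continuous functions and is closed under mixing of its members
by means of continuous functions into the unit interval. -/
structure IsMixing {X : Type*} [TopologicalSpace X] (DX : Submodule ℝ (X → ℝ)) : Prop where
  continuous : ∀ f ∈ DX, Continuous f
  mix : ∀ f ∈ DX, ∀ g ∈ DX, ∀ φ : C(X, ℝ), (∀ x, φ x ∈ Icc (0 : ℝ) 1) →
    (fun x => f x + φ x * (g x - f x)) ∈ DX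

theorem isMixing_of_eq {X : Type*} [TopologicalSpace X] {DX : Submodule ℝ (X → ℝ)}
    (h : DX = contFun X ∨ DX = bddContFun X) : IsMixing DX := by
  rcases h with rfl | rfl
  · refine ⟨fun f hf => hf, fun f hf g hg φ _ => ?_⟩
    have hf : Continuous f := hf
    have hg : Continuous g := hg
    exact hf.add (φ.continuous.mul (hg.sub hf))
  · refine ⟨fun f hf => hf.1, fun f hf g hg φ hφ => ?_⟩
    obtain ⟨hf, M, hM⟩ := hf
    obtain ⟨hg, N, hN⟩ := hg
    refine ⟨hf.add (φ.continuous.mul (hg.sub hf)), M + (N + M), fun x => ?_⟩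
    refine (abs_add_le _ _).trans (add_le_add (hM x) ?_)
    rw [abs_mul, abs_of_nonneg (hφ x).1]
    refine (mul_le_of_le_one_left (abs_nonneg _) (hφ x).2).trans ?_
    exact (abs_sub _ _).trans (add_le_add (hN x) (hM x))

theorem mem_of_continuous_of_bounded {Y : Type*} [TopologicalSpace Y] {DY : Submodule ℝ (Y → ℝ)}
    (h : DY = contFun Y ∨ DY = bddContFun Y) {g : Y → ℝ} (hg : Continuous g) {M : ℝ}
    (hM : ∀ y, |g y| ≤ M) : g ∈ DY := by
  rcases h with rfl | rfl
  exacts [hg, ⟨hg, M, hM⟩]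

section

variable {X Y : Type*} {DX : Submodule ℝ (X → ℝ)} {DY : Submodule ℝ (Y → ℝ)} {T : DX → DY}

theorem UniformContinuous.exists_finset_forall_abs_sub_lt (hT : UniformContinuous T) (y : Y)
    {ε : ℝ} (hε : 0 < ε) : ∃ (K : Finset X) (δ : ℝ), 0 < δ ∧ ∀ f g : DX,
      (∀ x ∈ K, |(f : X → ℝ) x - (g : X → ℝ) x| < δ) →
        |(T f : Y → ℝ) y - (T g : Y → ℝ) y| < ε := by
  have h1 : UniformContinuous fun f : DX => (T f : Y → ℝ) y :=
    (Pi.uniformContinuous_proj (fun _ : Y => ℝ) y).comp (uniformContinuous_subtype_val.comp hT)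
  have h2 := h1 (Metric.dist_mem_uniformity hε)
  rw [mem_map, uniformity_subtype, mem_comap] at h2
  obtain ⟨t, ht, hts⟩ := h2
  rw [Pi.uniformity] at ht
  obtain ⟨I, hI, V, hV, -, rfl, -⟩ := mem_iInf'.1 ht
  choose W hW hWV using fun i => mem_comap.1 (hV i)
  choose r hr hrW using fun i => Metric.mem_uniformity_dist.1 (hW i)
  obtain ⟨δ, hδ, hδr⟩ : ∃ δ : ℝ, 0 < δ ∧ ∀ i ∈ I, δ ≤ r i := by
    rcases I.eq_empty_or_nonempty with rfl | hne
    · exact ⟨1, one_pos, by simp⟩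
    · obtain ⟨i, -, hi⟩ := exists_min_image I r hI hne
      exact ⟨r i, hr i, hi⟩
  refine ⟨hI.toFinset, δ, hδ, fun f g hfg => ?_⟩
  have : ((f, g) : DX × DX) ∈ (fun p : DX × DX => ((p.1 : X → ℝ), (p.2 : X → ℝ))) ⁻¹'
      ⋂ i ∈ I, V i := by
    refine mem_iInter₂.2 fun i hi => hWV i (hrW i ?_)
    rw [Real.dist_eq]
    exact (hfg i (hI.mem_toFinset.2 hi)).trans_le (hδr i hi)
  have h3 := hts this
  simpa [Real.dist_eq] using h3

theorem UniformContinuous.exists_coarselyDependsOn (hT : UniformContinuous T) (y : Y) :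
    ∃ (K : Finset X) (n : ℕ), CoarselyDependsOn T y K n := by
  obtain ⟨K, δ, hδ, h⟩ := hT.exists_finset_forall_abs_sub_lt y one_pos
  obtain ⟨n, hn⟩ := exists_nat_gt (1 / δ)
  have hn0 : (0 : ℝ) < n := (by positivity : 0 < 1 / δ).trans hn
  refine ⟨K, n, fun f g hfg => ?_⟩
  -- Since `n > 1 / δ`, the segment from `f` to `g` splits into `n` steps smaller than `δ` on `K`,
  -- each costing at most 1.
  let p : ℕ → DX := fun i => f + ((i : ℝ) / n) • (g - f)
  have hstep : ∀ i, |(T (p i) : Y → ℝ) y - (T (p (i + 1)) : Y → ℝ) y| ≤ 1 := by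
    refine fun i => (h _ _ fun x hx => ?_).le
    have : (p i : X → ℝ) x - (p (i + 1) : X → ℝ) x
        = (1 / n) * ((f : X → ℝ) x - (g : X → ℝ) x) := by
      simp only [p, Submodule.coe_add, Submodule.coe_smul, Submodule.coe_sub, Pi.add_apply,
        Pi.smul_apply, Pi.sub_apply, smul_eq_mul]
      push_cast
      field_simp
      ring
    rw [this, abs_mul, abs_of_nonneg (by positivity)]
    calc 1 / (n : ℝ) * |(f : X → ℝ) x - (g : X → ℝ) x| ≤ 1 / n * 1 := by
          gcongr; exact (hfg x hx).le
      _ < δ := by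
          rw [mul_one, div_lt_iff₀ hn0]
          rwa [div_lt_iff₀ hδ, mul_comm] at hn
  have hsum : ∀ i : ℕ, |(T (p 0) : Y → ℝ) y - (T (p i) : Y → ℝ) y| ≤ i := by
    intro i
    induction i with
    | zero => simp
    | succ i ih =>
      push_cast
      exact (abs_sub_le _ _ _).trans (add_le_add ih (hstep i))
  have h0 : p 0 = f := by simp [p]
  have h1 : p n = g := by simp [p, div_self hn0.ne']
  simpa [h0, h1] using hsum n

theorem CoarselyDependsOn.mono {y : Y} {K L : Finset X} {q r : ℝ}
    (h : CoarselyDependsOn T y K q) (hKL : K ⊆ L) (hqr : q ≤ r) : CoarselyDependsOn T y L r :=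
  fun f g hfg => (h f g fun x hx => hfg x (hKL hx)).trans hqr

theorem CoarselyDependsOn.inter [TopologicalSpace X] [T4Space X] [DecidableEq X]
    (hDX : IsMixing DX) {y : Y} {K L : Finset X} {q r : ℝ} (hK : CoarselyDependsOn T y K q)
    (hL : CoarselyDependsOn T y L r) : CoarselyDependsOn T y (K ∩ L) (q + r) := by
  intro f g hfg
  obtain ⟨φ, h0, h1, hφ⟩ := exists_continuous_zero_one_of_isClosed
    (K.finite_toSet.isClosed) ((L \ K).finite_toSet.isClosed)
    (by rw [Finset.disjoint_coe]; exact Finset.disjoint_sdiff)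
  -- `h` equals `f` on `K` and `g` on `L \ K`.
  let h : DX := ⟨_, hDX.mix f f.2 g g.2 φ hφ⟩
  refine (abs_sub_le _ ((T h : Y → ℝ) y) _).trans (add_le_add (hK f h fun x hx => ?_)
    (hL h g fun x hx => ?_))
  · have : φ x = 0 := h0 hx
    simp [h, this]
  · by_cases hxK : x ∈ K
    · have : φ x = 0 := h0 hxK
      simpa [h, this] using hfg x (Finset.mem_inter.2 ⟨hxK, hx⟩)
    · have : φ x = 1 := h1 (Finset.mem_coe.2 (Finset.mem_sdiff.2 ⟨hx, hxK⟩))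
      simp [h, this]

/-- Only finitely many points of `Y` depend coarsely, with a given error, on a given finite set. -/
theorem InverselyBounded.finite_setOf_coarselyDependsOn [TopologicalSpace Y] [T4Space Y]
    (hT : InverselyBounded T) (hDY : ∀ g : Y → ℝ, Continuous g → ∀ M, (∀ y, |g y| ≤ M) → g ∈ DY)
    (K : Finset X) (q : ℕ) : {y | CoarselyDependsOn T y K q}.Finite := by
  by_contra hinf
  have hinf : {y | CoarselyDependsOn T y K q}.Infinite := hinf
  let e := hinf.natEmbedding
  have hφ : ∀ n, ∃ φ : C(Y, ℝ), (∀ m < n, φ (e m) = 0) ∧ φ (e n) = 1 ∧ ∀ y, φ y ∈ Icc (0 : ℝ) 1 := by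
    intro n
    obtain ⟨φ, h0, h1, h2⟩ := exists_continuous_zero_one_of_isClosed
      (((finite_Iio n).image fun m => (e m : Y)).isClosed) (isClosed_singleton (x := (e n : Y)))
      (by
        rw [disjoint_singleton_right]
        rintro ⟨m, hm, hmn⟩
        exact (ne_of_lt hm) (e.injective (Subtype.ext hmn)))
    exact ⟨φ, fun m hm => h0 ⟨m, hm, rfl⟩, h1 rfl, h2⟩
  choose φ h0 h1 hφ using hφ
  have hbd : ∀ n y, |((q : ℝ) + 1) * φ n y| ≤ q + 1 := by
    intro n y
    rw [abs_mul, abs_of_nonneg (hφ n y).1, abs_of_nonneg (by positivity)]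
    exact mul_le_of_le_one_right (by positivity) (hφ n y).2
  -- Any two of these differ by `q + 1` at one of the points. By compactness, two of their bounded
  -- preimages differ by less than 1 on `K`.
  let g : ℕ → DY := fun n => ⟨fun y => ((q : ℝ) + 1) * φ n y,
    hDY _ (continuous_const.mul (φ n).continuous) _ (hbd n)⟩
  obtain ⟨f, ⟨M, hM0, hM⟩, hf⟩ := hT g ⟨q + 1, by positivity, hbd⟩
  obtain ⟨a, -, s, hs, hlim⟩ := tendsto_subseq_of_bounded
    (Metric.isBounded_closedBall (x := (0 : K → ℝ)) (r := M))
    (x := fun n => fun x : K => (f n : X → ℝ) x) (fun n => by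
      rw [mem_closedBall_zero_iff, pi_norm_le_iff_of_nonneg hM0.le]
      exact fun x => hM n x)
  obtain ⟨N, hN⟩ := Metric.cauchySeq_iff.1 hlim.cauchySeq 1 one_pos
  have hlt : s N < s (N + 1) := hs N.lt_succ_self
  have h := (e (s N)).2 (f (s N)) (f (s (N + 1))) fun x hx =>
    (dist_le_pi_dist _ _ (⟨x, hx⟩ : K)).trans_lt (hN N le_rfl (N + 1) N.le_succ)
  rw [hf, hf] at h
  simp only [g, h1, h0 _ _ hlt, mul_one, mul_zero, sub_zero] at h
  rw [abs_of_nonneg (by positivity)] at h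
  linarith

end

/-! ### Limits of supports along an ultrafilter -/

/-- The points all of whose neighbourhoods are eventually met by the sets `K i`. -/
def limitPoints {X I : Type*} [TopologicalSpace X] (u : Ultrafilter I) (K : I → Finset X) : Set X :=
  {x | ∀ U ∈ 𝓝 x, ∀ᶠ i in u, ∃ z ∈ K i, z ∈ U}

section

variable {X I : Type*} [TopologicalSpace X] [T2Space X] {u : Ultrafilter I} {K : I → Finset X}

theorem eventually_exists_injOn_of_subset_limitPoints {L : Finset X} (hL : ↑L ⊆ limitPoints u K)
    {W : Set X} (hW : IsOpen W) (hLW : ↑L ⊆ W) :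
    ∀ᶠ i in u, ∃ z : X → X, InjOn z L ∧ ∀ x ∈ L, z x ∈ K i ∧ z x ∈ W := by
  obtain ⟨U, hU, hdisj⟩ := L.finite_toSet.t2_separation
  have : ∀ᶠ i in u, ∀ x ∈ L, ∃ z ∈ K i, z ∈ U x ∩ W :=
    (eventually_all_finset L).2 fun x hx =>
      hL hx _ (inter_mem ((hU x).2.mem_nhds (hU x).1) (hW.mem_nhds (hLW hx)))
  filter_upwards [this] with i hi
  choose! z hz hzU using hi
  refine ⟨z, fun x hx x' hx' he => ?_, fun x hx => ⟨hz x hx, (hzU x hx).2⟩⟩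
  by_contra hne
  exact disjoint_left.1 (hdisj hx hx' hne) (hzU x hx).1 (he ▸ (hzU x' hx').1)

theorem card_le_of_subset_limitPoints {L : Finset X} (hL : ↑L ⊆ limitPoints u K) {p : ℕ}
    (hK : ∀ᶠ i in u, (K i).card ≤ p) : L.card ≤ p := by
  obtain ⟨i, hi, z, hinj, hz⟩ := (hK.and
    (eventually_exists_injOn_of_subset_limitPoints hL isOpen_univ (subset_univ _))).exists
  exact (Finset.card_le_card_of_injOn z (fun x hx => (hz x hx).1) hinj).trans hi

theorem finite_limitPoints {p : ℕ} (hK : ∀ᶠ i in u, (K i).card ≤ p) :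
    (limitPoints u K).Finite := by
  by_contra hinf
  obtain ⟨L, hL, hc⟩ := Set.Infinite.exists_subset_card_eq hinf (p + 1)
  have := card_le_of_subset_limitPoints hL hK
  omega

end

section

variable {X Y : Type*} [TopologicalSpace X] [T4Space X] [TopologicalSpace Y]
  {DX : Submodule ℝ (X → ℝ)} {DY : Submodule ℝ (Y → ℝ)} {T : DX → DY}

/-- Away from the limit points the supports eventually disappear; near them `|f - g| < 1` persists
by continuity. Only finitely many neighbourhoods are needed, because `y` itself has a finite
support. -/
theorem coarselyDependsOn_limitPoints (hT : UniformContinuous T) (hDX : IsMixing DX)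
    (hDY : ∀ g ∈ DY, Continuous g) {u : Ultrafilter Y} {y : Y} (hu : ↑u ≤ 𝓝 y)
    {K : Y → Finset X} {q : ℝ} (hK : ∀ᶠ i in u, CoarselyDependsOn T i (K i) q) {L : Finset X}
    (hL : ↑L = limitPoints u K) : CoarselyDependsOn T y L q := by
  classical
  intro f g hfg
  refine le_of_forall_pos_lt_add fun ε hε => ?_
  obtain ⟨P, δ, hδ, hP⟩ := hT.exists_finset_forall_abs_sub_lt y hε
  have hU : ∀ x : X, ∃ U : Set X, IsOpen U ∧ x ∈ U ∧
      ∀ᶠ i in u, ∀ z ∈ K i, z ∈ U → |(f : X → ℝ) z - (g : X → ℝ) z| < 1 := by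
    intro x
    by_cases hx : x ∈ L
    · refine ⟨{z | |(f : X → ℝ) z - (g : X → ℝ) z| < 1}, ?_, hfg x hx, .of_forall fun i z _ h => h⟩
      exact isOpen_lt ((hDX.continuous f f.2).sub (hDX.continuous g g.2)).abs continuous_const
    · have hx' : x ∉ limitPoints u K := hL ▸ hx
      simp only [limitPoints, mem_ofPred_eq, not_forall] at hx'
      obtain ⟨V, hV, hVK⟩ := hx'
      obtain ⟨U, hUV, hUo, hxU⟩ := mem_nhds_iff.1 hV
      refine ⟨U, hUo, hxU, ?_⟩
      filter_upwards [Ultrafilter.eventually_not.2 hVK] with i hi z hz hzU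
      exact absurd ⟨z, hz, hUV hzU⟩ hi
  choose U hUo hxU hUK using hU
  obtain ⟨φ, h0, h1, hφ⟩ := exists_continuous_zero_one_of_isClosed
    (isOpen_biUnion fun x (_ : x ∈ P) => hUo x).isClosed_compl P.finite_toSet.isClosed
    (disjoint_left.2 fun x hx hxP => hx (mem_iUnion₂.2 ⟨x, hxP, hxU x⟩))
  -- `h` equals `g` on `P`, so `T h` is `ε`-close to `T g` at `y`; it equals `f` off the sets `U x`,
  -- so `|f - h| < 1` on `K i` eventually.
  let h : DX := ⟨_, hDX.mix f f.2 g g.2 φ hφ⟩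
  have hfh : |(T f : Y → ℝ) y - (T h : Y → ℝ) y| ≤ q := by
    have hlim : Tendsto (fun i => |(T f : Y → ℝ) i - (T h : Y → ℝ) i|) u
        (𝓝 |(T f : Y → ℝ) y - (T h : Y → ℝ) y|) :=
      (((hDY _ (T f).2).sub (hDY _ (T h).2)).abs.tendsto y).mono_left hu
    refine le_of_tendsto hlim ?_
    filter_upwards [hK, (eventually_all_finset P).2 fun x _ => hUK x] with i hi hiU
    refine hi f h fun z hz => ?_
    have hdiff : (f : X → ℝ) z - (h : X → ℝ) z = φ z * ((f : X → ℝ) z - (g : X → ℝ) z) := by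
      simp only [h]; ring
    rw [hdiff, abs_mul, abs_of_nonneg (hφ z).1]
    by_cases hzU : z ∈ ⋃ x ∈ P, U x
    · obtain ⟨x, hx, hzx⟩ := mem_iUnion₂.1 hzU
      exact (mul_le_of_le_one_left (abs_nonneg _) (hφ z).2).trans_lt (hiU x hx z hz hzx)
    · have : φ z = 0 := h0 hzU
      simp [this]
  have hhg : |(T h : Y → ℝ) y - (T g : Y → ℝ) y| < ε := by
    refine hP h g fun x hx => ?_
    have : φ x = 1 := h1 hx
    simpa [h, this] using hδ
  exact (abs_sub_le _ _ _).trans_lt (add_lt_add_of_le_of_lt hfh hhg)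

/-! ### Borel class of the support conditions -/

/-- The points of `Y` that depend coarsely on fewer than `p` points. -/
def smallSupport (T : DX → DY) (p : ℕ) (q : ℝ) : Set Y :=
  {y | ∃ K : Finset X, K.card < p ∧ CoarselyDependsOn T y K q}

/-- The points of `Y` that depend coarsely on `p` points, one of them in `F`. -/
def supportMeets (T : DX → DY) (p : ℕ) (q : ℝ) (F : Set X) : Set Y :=
  {y | ∃ K : Finset X, K.card = p ∧ CoarselyDependsOn T y K q ∧ ∃ x ∈ K, x ∈ F}

theorem isClosed_smallSupport (hT : UniformContinuous T) (hDX : IsMixing DX)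
    (hDY : ∀ g ∈ DY, Continuous g) (p : ℕ) (q : ℝ) : IsClosed (smallSupport T p q) := by
  refine isClosed_of_closure_subset fun y hy => ?_
  obtain ⟨u, hu, huy⟩ := mem_closure_iff_ultrafilter.1 hy
  choose! K hKc hK using fun (i : Y) (hi : i ∈ smallSupport T p q) => hi
  have hc : ∀ᶠ i in u, (K i).card ≤ p - 1 := by
    filter_upwards [hu] with i hi
    have := hKc i hi
    omega
  -- Positivity makes the truncated bound `p - 1` a strict one.
  have hp : 0 < p := by
    obtain ⟨i, hi⟩ := u.nonempty_of_mem hu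
    exact (Nat.zero_le _).trans_lt (hKc i hi)
  have hL : ↑(finite_limitPoints hc).toFinset = limitPoints u K := Finite.coe_toFinset _
  refine ⟨_, ?_, coarselyDependsOn_limitPoints hT hDX hDY huy (mem_of_superset hu hK) hL⟩
  have := card_le_of_subset_limitPoints hL.subset hc
  omega

theorem closure_supportMeets_subset (hT : UniformContinuous T) (hDX : IsMixing DX)
    (hDY : ∀ g ∈ DY, Continuous g) (p : ℕ) (q : ℝ) {F : Set X} (hF : IsClosed F) :
    closure (supportMeets T p q F) ⊆ supportMeets T p q F ∪ smallSupport T p q := by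
  intro y hy
  obtain ⟨u, hu, huy⟩ := mem_closure_iff_ultrafilter.1 hy
  choose! K hKc hK hKF using fun (i : Y) (hi : i ∈ supportMeets T p q F) => hi
  have hc : ∀ᶠ i in u, (K i).card ≤ p := by
    filter_upwards [hu] with i hi using (hKc i hi).le
  obtain ⟨L, hL⟩ : ∃ L : Finset X, ↑L = limitPoints u K :=
    ⟨_, Finite.coe_toFinset (finite_limitPoints hc)⟩
  have hdep := coarselyDependsOn_limitPoints hT hDX hDY huy (mem_of_superset hu hK) hL
  rcases (card_le_of_subset_limitPoints hL.subset hc).lt_or_eq with hlt | heq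
  · exact Or.inr ⟨L, hlt, hdep⟩
  refine Or.inl ⟨L, heq, hdep, ?_⟩
  by_contra! hLF
  -- With `L` of full size `p`, the injection `z` is onto `K i`; were `L` disjoint from `F`, so
  -- would be `K i`.
  obtain ⟨i, hi, z, hinj, hz⟩ := (Eventually.and hu (eventually_exists_injOn_of_subset_limitPoints
    hL.subset hF.isOpen_compl hLF)).exists
  obtain ⟨x, hxK, hxF⟩ := hKF i hi
  obtain ⟨x', hx', rfl⟩ := Finset.surj_on_of_inj_on_of_card_le (fun a (_ : a ∈ L) => z a)
    (fun a ha => (hz a ha).1) (fun a b ha hb => hinj ha hb)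
    (heq.symm ▸ (hKc i hi).le) x hxK
  exact (hz x' hx').2 hxF

/-- Taking the closure adds only points of `smallSupport`, so the difference is a closed set minus a
closed set. -/
theorem isGδ_compl_supportMeets_diff [TopologicalSpace.MetrizableSpace Y]
    (hT : UniformContinuous T) (hDX : IsMixing DX) (hDY : ∀ g ∈ DY, Continuous g)
    (p : ℕ) {q r : ℝ} (hqr : q ≤ r) {F : Set X} (hF : IsClosed F) :
    IsGδ (supportMeets T p q F \ smallSupport T p r)ᶜ := by
  let _ := TopologicalSpace.metrizableSpaceMetric Y
  have : (supportMeets T p q F \ smallSupport T p r)ᶜ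
      = (closure (supportMeets T p q F))ᶜ ∪ smallSupport T p r := by
    rw [sdiff_eq, compl_inter, compl_compl]
    refine Subset.antisymm (fun y hy => ?_)
      (union_subset_union_left _ (compl_subset_compl.2 subset_closure))
    by_cases hys : y ∈ smallSupport T p r
    · exact Or.inr hys
    refine Or.inl fun hyc => ?_
    rcases closure_supportMeets_subset hT hDX hDY p q hF hyc with h | ⟨K, hKp, hK⟩
    · exact hy.elim (fun h' => h' h) hys
    · exact hys ⟨K, hKp, hK.mono subset_rfl hqr⟩
  rw [this]
  exact isClosed_closure.isOpen_compl.isGδ.union (isClosed_smallSupport hT hDX hDY p r).isGδ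

-- Otherwise `K ∩ L` would be a smaller support with error `q + q`.
omit [TopologicalSpace Y] in
theorem CoarselyDependsOn.eq_of_notMem_smallSupport (hDX : IsMixing DX) {y : Y} {p : ℕ} {q : ℝ}
    {K L : Finset X} (hKp : K.card = p) (hLp : L.card = p) (hK : CoarselyDependsOn T y K q)
    (hL : CoarselyDependsOn T y L q) (hy : y ∉ smallSupport T p (q + q)) : K = L := by
  classical
  have hle : p ≤ (K ∩ L).card := by
    by_contra! hlt
    exact hy ⟨_, hlt, hK.inter hDX hL⟩
  exact (Finset.eq_of_subset_of_card_le Finset.inter_subset_left (hKp ▸ hle)).symm.trans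
    (Finset.eq_of_subset_of_card_le Finset.inter_subset_right (hLp ▸ hle))

omit [TopologicalSpace X] [T4Space X] [TopologicalSpace Y] in
theorem exists_coarselyDependsOn_notMem_smallSupport (hT : UniformContinuous T) (y : Y) :
    ∃ (K : Finset X) (q : ℕ), CoarselyDependsOn T y K q ∧
      ∀ r : ℕ, y ∉ smallSupport T K.card (r + r) := by
  classical
  have hex : ∃ p : ℕ, ∃ K : Finset X, K.card = p ∧ ∃ q : ℕ, CoarselyDependsOn T y K q :=
    (hT.exists_coarselyDependsOn y).elim fun K hK => ⟨_, K, rfl, hK⟩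
  -- The size is least over all errors at once, so no larger error allows a smaller support.
  obtain ⟨K, hKp, q, hK⟩ := Nat.find_spec hex
  refine ⟨K, q, hK, fun r ⟨L, hL, hLd⟩ => Nat.find_min hex (hKp ▸ hL) ⟨L, rfl, r + r, ?_⟩⟩
  exact_mod_cast hLd

end

/-! ### The main theorem -/

theorem theorem4p7 {X : Type*} {Y : Type*}
    [TopologicalSpace X] [TopologicalSpace.MetrizableSpace X]
    [TopologicalSpace Y] [TopologicalSpace.MetrizableSpace Y]
    (DX : Submodule ℝ (X → ℝ)) (hDX : DX = contFun X ∨ DX = bddContFun X)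
    (DY : Submodule ℝ (Y → ℝ)) (hDY : DY = contFun Y ∨ DY = bddContFun Y)
    (T : DX → DY) (hTuc : UniformContinuous T) (hTsurj : Function.Surjective T)
    (hTib : InverselyBounded T) (hX : IsDeltaOneSpace X) :
    IsDeltaOneSpace Y := by
  let _ := TopologicalSpace.metrizableSpaceMetric X
  let _ := TopologicalSpace.metrizableSpaceMetric Y
  have hmix := isMixing_of_eq hDX
  have hcont := (isMixing_of_eq hDY).continuous
  refine isDeltaOneSpace_of_countable_isGδ fun B hB => ?_
  -- For each `b`, `p`, `q` at most one `K` contributes, so `A` is countable.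
  let A : Set X := ⋃ b ∈ B, ⋃ p : ℕ, ⋃ q : ℕ,
    {x | b ∉ smallSupport T p (q + q) ∧
      ∃ K : Finset X, K.card = p ∧ CoarselyDependsOn T b K q ∧ x ∈ K}
  have hA : A.Countable := by
    refine hB.biUnion fun b _ => countable_iUnion fun p => countable_iUnion fun q => ?_
    by_cases h : ∃ K : Finset X, K.card = p ∧ CoarselyDependsOn T b K q
    · obtain ⟨K, hKp, hK⟩ := h
      refine K.countable_toSet.mono ?_
      rintro x ⟨hb, L, hLp, hL, hx⟩
      rwa [Finset.mem_coe, hK.eq_of_notMem_smallSupport hmix hKp hLp hL hb]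
    · refine countable_empty.mono ?_
      rintro x ⟨-, L, hLp, hL, -⟩
      exact h ⟨L, hLp, hL⟩
  obtain ⟨O, hO, hAO⟩ := (hX.isGδ_of_countable hA).eq_iInter_nat
  let G : Set Y := ⋂ p : ℕ, ⋂ q : ℕ, ⋂ k : ℕ,
    (supportMeets T p q (O k)ᶜ \ smallSupport T p (q + q))ᶜ
  have hG : IsGδ G := .iInter fun p => .iInter fun q => .iInter fun k =>
    isGδ_compl_supportMeets_diff hTuc hmix hcont p (by simp) (hO k).isClosed_compl
  have hBG : B ⊆ G := by
    intro b hb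
    simp only [G, mem_iInter]
    rintro p q k ⟨⟨K, hKp, hK, x, hx, hxO⟩, hs⟩
    have hxA : x ∈ A := mem_iUnion₂.2 ⟨b, hb, mem_iUnion₂.2 ⟨p, q, hs, K, hKp, hK, hx⟩⟩
    exact hxO (mem_iInter.1 (hAO ▸ hxA) k)
  have hGc : G.Countable := by
    have hsub : G ⊆ ⋃ K ∈ {K : Finset X | ↑K ⊆ A}, ⋃ q : ℕ, {y | CoarselyDependsOn T y K q} := by
      intro y hy
      obtain ⟨K, q, hK, hs⟩ := exists_coarselyDependsOn_notMem_smallSupport hTuc y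
      refine mem_iUnion₂.2 ⟨K, fun x hx => ?_, mem_iUnion.2 ⟨q, hK⟩⟩
      rw [hAO]
      refine mem_iInter.2 fun k => ?_
      by_contra hxO
      simp only [G, mem_iInter] at hy
      -- A minimal support has no smaller replacement, so membership in `G` forces it into every `O
      -- k`.
      exact hy K.card q k ⟨⟨K, rfl, hK, x, hx, hxO⟩, hs q⟩
    refine Countable.mono hsub (Countable.biUnion ?_ fun K _ => countable_iUnion fun q =>
      (hTib.finite_setOf_coarselyDependsOn
        (fun g hg M hM => mem_of_continuous_of_bounded hDY hg hM) K q).countable)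
    have hmaps : MapsTo (fun K : Finset X => (K : Set X)) {K | ↑K ⊆ A} {t | t.Finite ∧ t ⊆ A} :=
      fun K hK => ⟨K.finite_toSet, hK⟩
    exact hmaps.countable_of_injOn Finset.coe_injective.injOn (countable_ofPred_finite_subset hA)
  have : B = G ∩ (G \ B)ᶜ := by
    ext y
    simp only [mem_inter_iff, mem_compl_iff, Set.mem_sdiff]
    constructor
    · exact fun h => ⟨hBG h, fun h' => h'.2 h⟩
    · rintro ⟨h1, h2⟩
      by_contra h3
      exact h2 ⟨h1, h3⟩
  rw [this]
  exact hG.inter (hGc.mono sdiff_subset).isGδ_compl
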